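/- For $n\ge 1$ and $\alpha_1,\dots,\alpha_n>0$, the Dirichlet distribution $\mathrm{Dir}(\alpha_1,\dots,\alpha_n)$ is the probability measure on $\mathbb{R}^n$ with density $$f(x_1,\dots,x_n)=\frac{\Gamma(\alpha_1+\dots+\alpha_n)}{\Gamma(\alpha_1)\cdots\Gamma(\alpha_n)}\,x_1^{\alpha_1-1}\cdots x_n^{\alpha_n-1}\,1_{\Delta_n}(x_1,\dots,x_n),\qquad \Delta_n=\{x_1,\dots,x_n\ge 0:\ x_1+\dots+x_n=1\},$$ with respect to the Lebesgue measure $dx_1\cdots dx_{n-1}$ on the hyperplane $x_1+\dots+x_n=1$ (for $n=1$, the unit mass at the point $1$). Let $(X_1,\dots,X_n)$ be a random vector with law $\mathrm{Dir}(\alpha_1,\dots,\alpha_n)$, where $n\ge 1$ and $\alpha_1,\dots,\alpha_n>0$. Then: 1. (Aggregation) If $[n]=\{1,\dots,n\}$ is partitioned into non-empty subsets $B_1,\dots,B_k$, then $$\Big(\sum_{i\in B_1}X_i,\dots,\sum_{i\in B_k}X_i\Big)\sim \mathrm{Dir}\Big(\sum_{i\in B_1}\alpha_i,\dots,\sum_{i\in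 B_k}\alpha_i\Big).$$ 2. (Neutrality) Let $I=(i_1,\dots,i_k)$, $k\ge 1$, be a non-empty ordered subset of $[n]$, that is, a tuple of distinct elements of $[n]$ in an arbitrary order. Let $I^c$ be its complement in $[n]$, and write $\alpha_I=(\alpha_{i_1},\dots,\alpha_{i_k})$ and $X_I=(X_{i_1},\dots,X_{i_k})$. Then $\tilde X_I = X_I/\sum_{i\in I}X_i$ (which is almost surely well defined) has law $\mathrm{Dir}(\alpha_I)$ and is independent of $X_{I^c}=(X_i)_{i\in I^c}$. -/

import Mathlib

open MeasureTheory ProbabilityTheory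

/-- The Lebesgue measure on the hyperplane `x₁ + ⋯ + xₙ = 1` of `ℝⁿ`, in the coordinates
`x₁, …, xₙ₋₁`: the image of the Lebesgue measure of `ℝⁿ⁻¹` under
`(x₁, …, xₙ₋₁) ↦ (x₁, …, xₙ₋₁, 1 - x₁ - ⋯ - xₙ₋₁)`. For `n = 0` the hyperplane is empty, and for
`n = 1` this is the unit mass at the point `1`. -/
noncomputable def hyperplaneVolume : (n : ℕ) → Measure (Fin n → ℝ)
  | 0 => 0
  | m + 1 => (volume : Measure (Fin m → ℝ)).map
      (fun y => (Fin.snoc (α := fun _ => ℝ) y (1 - ∑ j, y j) : Fin (m + 1) → ℝ))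

/-- The Dirichlet density
`Γ(α₁ + ⋯ + αₙ) / (Γ(α₁) ⋯ Γ(αₙ)) * x₁ ^ (α₁ - 1) ⋯ xₙ ^ (αₙ - 1)` on the simplex
`{x₁, …, xₙ ≥ 0, x₁ + ⋯ + xₙ = 1}`, extended by `0`. -/
noncomputable def dirichletPDFReal {n : ℕ} (α : Fin n → ℝ) : (Fin n → ℝ) → ℝ :=
  (stdSimplex ℝ (Fin n)).indicator fun x =>
    Real.Gamma (∑ i, α i) / (∏ i, Real.Gamma (α i)) * ∏ i, x i ^ (α i - 1)

/-- The Dirichlet distribution `Dir(α₁, …, αₙ)`, for `n ≥ 1` and `α₁, …, αₙ > 0`. -/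
noncomputable def dirichletMeasure {n : ℕ} (α : Fin n → ℝ) : Measure (Fin n → ℝ) :=
  (hyperplaneVolume n).withDensity fun x => ENNReal.ofReal (dirichletPDFReal α x)

/-!
The Dirichlet law is the law of `(g₁ / S, …, gₙ / S)` with `S = g₁ + ⋯ + gₙ`, for independent
variables `gᵢ` of law `gammaMeasure (αᵢ) 1`, and these ratios are independent of `S`, which has law
`gammaMeasure (α₁ + ⋯ + αₙ) 1`. This is `map_sum_div_pi_gammaMeasure`: in the coordinates
`x = s • u` with `u` on the hyperplane of sum `1` (`lintegral_eq_lintegral_hyperplaneVolume`), the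
product of the gamma densities splits as a gamma density in `s` times the Dirichlet density in `u`
(`prod_gammaPDF_smul`).

Both assertions concern only the law of `X`, so `X` may be taken to be the vector of ratios `g / S`.

* Aggregation: the sums of the `gᵢ` over disjoint blocks are independent gamma variables
  (`iIndepFun.finset_sum`, `iIndepFun.hasLaw_sum_gammaMeasure`), and the block sums of `g / S` are
  the ratios of these sums to their total.
* Neutrality: the ratios of `X_I` to their sum are those of `g_I` to `S_I`, the sum of `g_I`. They
  have the Dirichlet law and are independent of `S_I`, and the pair of them is independent of the
  `gᵢ` with `i` outside `I`. Hence the ratios are independent of `S_I` together with these `gᵢ`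
  (`IndepFun.prodMk_right_of_prodMk_left`), of which `X_{Iᶜ}` is a function.
-/

/-! ### Products of measures with densities -/

/-- Tonelli for a product of functions of one coordinate each. -/
lemma lintegral_prod_coord {n : ℕ} (f : Fin n → ℝ → ENNReal) (hf : ∀ i, Measurable (f i)) :
    ∫⁻ x : Fin n → ℝ, ∏ i, f i (x i) = ∏ i, ∫⁻ t, f i t := by
  induction n with
  | zero => simp [volume_pi]
  | succ n ih =>
    rw [← (volume_preserving_piFinSuccAbove (fun _ : Fin (n + 1) => ℝ) 0).symm.lintegral_comp
      (by fun_prop), Measure.volume_eq_prod, Fin.prod_univ_succ,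
      ← ih (fun i => f i.succ) (fun i => hf _),
      ← lintegral_prod_mul (hf 0).aemeasurable (Measurable.aemeasurable (by fun_prop))]
    simp [Fin.prod_univ_succ, MeasurableEquiv.piFinSuccAbove]

/-- A product of measures with densities on the line has the product density. -/
lemma pi_withDensity {n : ℕ} (f : Fin n → ℝ → ENNReal) (hf : ∀ i, Measurable (f i))
    [∀ i, SigmaFinite (volume.withDensity (f i))] :
    Measure.pi (fun i => volume.withDensity (f i)) =
      (volume : Measure (Fin n → ℝ)).withDensity fun x => ∏ i, f i (x i) := by
  refine Measure.pi_eq fun s hs => ?_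
  rw [withDensity_apply _ (MeasurableSet.univ_pi hs),
    ← lintegral_indicator (MeasurableSet.univ_pi hs)]
  have h (x : Fin n → ℝ) : (Set.univ.pi s).indicator (fun x => ∏ i, f i (x i)) x =
      ∏ i, (s i).indicator (f i) (x i) := by
    by_cases hx : x ∈ Set.univ.pi s
    · rw [Set.indicator_of_mem hx]
      exact Finset.prod_congr rfl fun i _ => (Set.indicator_of_mem (hx i trivial) _).symm
    · rw [Set.indicator_of_notMem hx]
      obtain ⟨i, hi⟩ : ∃ i, x i ∉ s i := by simpa using hx
      exact (Finset.prod_eq_zero (Finset.mem_univ i) (Set.indicator_of_notMem hi _)).symm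
  simp_rw [h]
  rw [lintegral_prod_coord _ fun i => (hf i).indicator (hs i)]
  exact Finset.prod_congr rfl fun i _ => by
    rw [lintegral_indicator (hs i), withDensity_apply _ (hs i)]

/-! ### Lebesgue measure and the hyperplane of sum one -/

lemma measurable_snoc_sub_sum (m : ℕ) : Measurable fun p : ℝ × (Fin m → ℝ) =>
    (Fin.snoc (α := fun _ => ℝ) p.2 (p.1 - ∑ j, p.2 j) : Fin (m + 1) → ℝ) := by
  refine measurable_pi_iff.2 (Fin.lastCases ?_ fun i => ?_)
  · simp only [Fin.snoc_last]; fun_prop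
  · simp only [Fin.snoc_castSucc]; fun_prop

lemma measurable_snoc_one_sub_sum (m : ℕ) : Measurable fun y : Fin m → ℝ =>
    (Fin.snoc (α := fun _ => ℝ) y (1 - ∑ j, y j) : Fin (m + 1) → ℝ) :=
  (measurable_snoc_sub_sum m).comp (measurable_const.prodMk measurable_id)

instance sFinite_hyperplaneVolume (n : ℕ) : SFinite (hyperplaneVolume n) := by
  cases n <;> (unfold hyperplaneVolume; infer_instance)

lemma ae_sum_eq_one_hyperplaneVolume (n : ℕ) : ∀ᵐ u ∂hyperplaneVolume n, ∑ i, u i = 1 := by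
  cases n with
  | zero => simp [hyperplaneVolume]
  | succ m =>
    rw [hyperplaneVolume, ae_map_iff (measurable_snoc_one_sub_sum m).aemeasurable
      (measurableSet_eq_fun (by fun_prop) (by fun_prop))]
    exact .of_forall fun y => by simp [Fin.sum_univ_castSucc]

/-- Integration in the coordinates `(s, u)`, where `s` is the sum of the entries of `x = s • u` and
`u` lies on the hyperplane of vectors with sum `1`: the shear `xₘ₊₁ = s - y₁ - ⋯ - yₘ` preserves
volume, and rescaling the other `m` coordinates by `s` contributes the Jacobian `|s| ^ m`. -/
lemma lintegral_eq_lintegral_hyperplaneVolume {m : ℕ} {F : (Fin (m + 1) → ℝ) → ENNReal}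
    (hF : Measurable F) :
    ∫⁻ x, F x = ∫⁻ s : ℝ, ENNReal.ofReal (|s| ^ m) * ∫⁻ u, F (s • u) ∂hyperplaneVolume (m + 1) := by
  have hsn := measurable_snoc_sub_sum m
  calc ∫⁻ x, F x
      = ∫⁻ y : Fin m → ℝ, ∫⁻ t : ℝ, F (Fin.snoc (α := fun _ => ℝ) y t) := by
        rw [← (volume_preserving_piFinSuccAbove
          (fun _ : Fin (m + 1) => ℝ) (Fin.last m)).symm.lintegral_comp hF, Measure.volume_eq_prod,
          lintegral_prod_symm' _ (by fun_prop)]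
        simp [MeasurableEquiv.piFinSuccAbove]
        rfl
    _ = ∫⁻ y : Fin m → ℝ, ∫⁻ s : ℝ, F (Fin.snoc (α := fun _ => ℝ) y (s - ∑ j, y j)) := by
        refine lintegral_congr fun y => ?_
        exact (lintegral_sub_right_eq_self (fun t => F (Fin.snoc (α := fun _ => ℝ) y t)) _).symm
    _ = ∫⁻ s : ℝ, ∫⁻ y : Fin m → ℝ, F (Fin.snoc (α := fun _ => ℝ) y (s - ∑ j, y j)) :=
        lintegral_lintegral_swap
          ((hF.comp hsn).comp measurable_swap).aemeasurable
    _ = _ := by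
        have h0 : ∀ᵐ s : ℝ, s ≠ 0 := Measure.ae_ne volume 0
        refine lintegral_congr_ae ?_
        filter_upwards [h0] with s hs
        have hmap : (volume : Measure (Fin m → ℝ)) =
            ENNReal.ofReal (|s| ^ m) • volume.map (s • ·) := by
          rw [Measure.map_addHaar_smul _ hs, smul_smul, ← ENNReal.ofReal_mul (by positivity)]
          simp [abs_inv, abs_pow, hs]
        rw [hyperplaneVolume, lintegral_map (by fun_prop) (measurable_snoc_one_sub_sum m)]
        conv_lhs => rw [hmap]
        have hFs : Measurable fun y : Fin m → ℝ =>
            F (Fin.snoc (α := fun _ => ℝ) y (s - ∑ j, y j)) :=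
          (hF.comp hsn).comp (measurable_const.prodMk measurable_id)
        rw [lintegral_smul_measure, lintegral_map hFs (by fun_prop), smul_eq_mul]
        congr 1
        refine lintegral_congr fun y => congrArg F ?_
        funext i
        refine Fin.lastCases ?_ (fun i => ?_) i
        · simp [mul_sub, Finset.mul_sum]
        · simp

/-! ### Gamma and Dirichlet laws -/

/-- The product of gamma densities factors in the coordinates `(s, u)`, thanks to
`∑ i, u i = 1`: the exponentials combine to `exp (-s)` and the powers of `s`, together with the
Jacobian `|s| ^ m`, to `s ^ (∑ i, α i - 1)`. -/
lemma prod_gammaPDF_smul {m : ℕ} {α : Fin (m + 1) → ℝ} (hα : ∀ i, 0 < α i) {s : ℝ} (hs : s ≠ 0)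
    {u : Fin (m + 1) → ℝ} (hu : ∑ i, u i = 1) :
    ENNReal.ofReal (|s| ^ m) * ∏ i, gammaPDF (α i) 1 (s * u i) =
      gammaPDF (∑ i, α i) 1 s * ENNReal.ofReal (dirichletPDFReal α u) := by
  rcases hs.lt_or_gt with hs | hs
  -- For negative `s`, some entry of `u` is positive, so some `s * u i` is negative.
  · obtain ⟨i, -, hi⟩ : ∃ i ∈ Finset.univ, 0 < u i := by
      by_contra! h
      linarith [Finset.sum_nonpos h]
    rw [gammaPDF_of_neg hs, zero_mul, Finset.prod_eq_zero (Finset.mem_univ i)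
      (gammaPDF_of_neg (mul_neg_of_neg_of_pos hs hi)), mul_zero]
  by_cases hu0 : ∀ i, 0 ≤ u i
  · have hG (i) : 0 < Real.Gamma (α i) := Real.Gamma_pos_of_pos (hα i)
    have hGs : 0 < Real.Gamma (∑ i, α i) := Real.Gamma_pos_of_pos
      (Finset.sum_pos (fun i _ => hα i) Finset.univ_nonempty)
    rw [gammaPDF_of_nonneg hs.le, dirichletPDFReal,
      Set.indicator_of_mem (show u ∈ stdSimplex ℝ _ from ⟨hu0, hu⟩)]
    simp_rw [fun i => gammaPDF_of_nonneg (a := α i) (r := 1) (mul_nonneg hs.le (hu0 i))]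
    have hnn (i) : 0 ≤ (s * u i) ^ (α i - 1) := Real.rpow_nonneg (mul_nonneg hs.le (hu0 i)) _
    rw [← ENNReal.ofReal_prod_of_nonneg fun i _ => by have := hnn i; have := hG i; positivity,
      ← ENNReal.ofReal_mul (by positivity), ← ENNReal.ofReal_mul (by positivity)]
    congr 1
    simp_rw [fun i => Real.mul_rpow (z := α i - 1) hs.le (hu0 i), Finset.prod_mul_distrib,
      Real.one_rpow, Finset.prod_div_distrib, one_mul, ← Real.exp_sum, Finset.sum_neg_distrib,
      ← Finset.mul_sum, hu, mul_one, ← Real.rpow_sum_of_pos hs, abs_of_pos hs]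
    have hpow : s ^ (∑ i, α i - 1) = s ^ m * s ^ (∑ i, (α i - 1)) := by
      rw [← Real.rpow_natCast, ← Real.rpow_add hs]
      congr 1
      simp only [Finset.sum_sub_distrib, Finset.sum_const, Finset.card_univ, Fintype.card_fin,
        nsmul_eq_mul, Nat.cast_add, Nat.cast_one]
      ring
    rw [hpow]
    have := (Finset.prod_pos fun i (_ : i ∈ Finset.univ) => hG i).ne'
    simp only [Finset.prod_const_one]
    field_simp
  · obtain ⟨i, hi⟩ := not_forall.1 hu0
    rw [dirichletPDFReal, Set.indicator_of_notMem fun h => hi (h.1 i), ENNReal.ofReal_zero,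
      mul_zero, Finset.prod_eq_zero (Finset.mem_univ i)
      (gammaPDF_of_neg (mul_neg_of_pos_of_neg hs (not_le.1 hi))), mul_zero]

lemma measurable_dirichletPDFReal {n : ℕ} (α : Fin n → ℝ) : Measurable (dirichletPDFReal α) := by
  refine Measurable.indicator (by fun_prop) ?_
  exact (isClosed_stdSimplex ℝ (Fin n)).measurableSet

instance sFinite_dirichletMeasure {n : ℕ} (α : Fin n → ℝ) : SFinite (dirichletMeasure α) := by
  unfold dirichletMeasure; infer_instance

lemma measurable_gammaPDF (a r : ℝ) : Measurable (gammaPDF a r) :=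
  (measurable_gammaPDFReal a r).ennreal_ofReal

/-- For independent gamma variables of rate `1`, the sum is gamma distributed, the vector of ratios
to the sum is Dirichlet distributed, and the two are independent. -/
theorem map_sum_div_pi_gammaMeasure {n : ℕ} (hn : 0 < n) {α : Fin n → ℝ} (hα : ∀ i, 0 < α i) :
    (Measure.pi fun i => gammaMeasure (α i) 1).map
      (fun g => (∑ i, g i, fun i => g i / ∑ l, g l)) =
    (gammaMeasure (∑ i, α i) 1).prod (dirichletMeasure α) := by
  obtain ⟨m, rfl⟩ : ∃ m, n = m + 1 := ⟨n - 1, by omega⟩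
  have hprob (i : Fin (m + 1)) : IsProbabilityMeasure (volume.withDensity (gammaPDF (α i) 1)) :=
    isProbabilityMeasure_gammaMeasure (hα i) one_pos
  have hg (a : ℝ) := measurable_gammaPDF a 1
  have hd := (measurable_dirichletPDFReal α).ennreal_ofReal
  refine Measure.ext_of_lintegral _ fun F hF => ?_
  have hM : Measurable fun g : Fin (m + 1) → ℝ => (∑ i, g i, fun i => g i / ∑ l, g l) := by
    fun_prop
  rw [lintegral_map hF hM, lintegral_prod _ hF.aemeasurable]
  simp only [gammaMeasure, dirichletMeasure]
  rw [pi_withDensity (fun i => gammaPDF (α i) 1) fun i => hg _,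
    lintegral_withDensity_eq_lintegral_mul _ (by fun_prop) (by fun_prop),
    lintegral_eq_lintegral_hyperplaneVolume (by fun_prop),
    lintegral_withDensity_eq_lintegral_mul _ (hg _) (by
      exact hF.lintegral_prod_right')]
  refine lintegral_congr_ae ?_
  filter_upwards [Measure.ae_ne volume (0 : ℝ)] with s hs
  simp only [Pi.mul_apply]
  rw [← lintegral_const_mul _ (by fun_prop), lintegral_withDensity_eq_lintegral_mul _ hd
    (by fun_prop), ← lintegral_const_mul _ (by fun_prop)]
  refine lintegral_congr_ae ?_
  filter_upwards [ae_sum_eq_one_hyperplaneVolume (m + 1)] with u hu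
  simp only [Pi.mul_apply, Pi.smul_apply, smul_eq_mul]
  rw [← mul_assoc, ← mul_assoc, prod_gammaPDF_smul hα hs hu]
  simp [← Finset.mul_sum, hu, hs]

/-- No Dirichlet integral is computed: the total mass is read off from the factorization of a
product of gamma laws, in which everything else is known to have mass `1`. -/
theorem isProbabilityMeasure_dirichletMeasure {n : ℕ} (hn : 0 < n) {α : Fin n → ℝ}
    (hα : ∀ i, 0 < α i) : IsProbabilityMeasure (dirichletMeasure α) := by
  have (i : Fin n) : IsProbabilityMeasure (gammaMeasure (α i) 1) :=
    isProbabilityMeasure_gammaMeasure (hα i) one_pos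
  have : Nonempty (Fin n) := ⟨⟨0, hn⟩⟩
  have : IsProbabilityMeasure (gammaMeasure (∑ i, α i) 1) :=
    isProbabilityMeasure_gammaMeasure
      (Finset.sum_pos (fun i _ => hα i) Finset.univ_nonempty) one_pos
  have h := congrArg (fun ν => ν Set.univ) (map_sum_div_pi_gammaMeasure hn hα)
  simp only [← Set.univ_prod_univ, Measure.prod_prod, measure_univ, one_mul] at h
  rw [Set.univ_prod_univ, Measure.map_apply (by fun_prop) .univ, Set.preimage_univ,
    measure_univ] at h
  exact ⟨h.symm⟩

lemma sFinite_gammaMeasure (a r : ℝ) : SFinite (gammaMeasure a r) := by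
  unfold gammaMeasure; infer_instance

section

variable {Ω : Type*} {mΩ : MeasurableSpace Ω} {P : Measure Ω} {n : ℕ} {α : Fin n → ℝ}
  {G : Ω → Fin n → ℝ}

lemma hasLaw_sum_div (hn : 0 < n) (hα : ∀ i, 0 < α i)
    (hG : HasLaw G (Measure.pi fun i => gammaMeasure (α i) 1) P) :
    HasLaw (fun ω => (∑ i, G ω i, fun i => G ω i / ∑ l, G ω l))
      ((gammaMeasure (∑ i, α i) 1).prod (dirichletMeasure α)) P :=
  HasLaw.fun_comp (Y := fun g : Fin n → ℝ => (∑ i, g i, fun i => g i / ∑ l, g l))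
    ⟨by fun_prop, map_sum_div_pi_gammaMeasure hn hα⟩ hG

lemma hasLaw_sum (hn : 0 < n) (hα : ∀ i, 0 < α i)
    (hG : HasLaw G (Measure.pi fun i => gammaMeasure (α i) 1) P) :
    HasLaw (fun ω => ∑ i, G ω i) (gammaMeasure (∑ i, α i) 1) P := by
  have := isProbabilityMeasure_dirichletMeasure hn hα
  have := sFinite_gammaMeasure (∑ i, α i) 1
  exact measurePreserving_fst.fun_comp_hasLaw (hasLaw_sum_div hn hα hG)

lemma hasLaw_div_sum (hn : 0 < n) (hα : ∀ i, 0 < α i)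
    (hG : HasLaw G (Measure.pi fun i => gammaMeasure (α i) 1) P) :
    HasLaw (fun ω i => G ω i / ∑ l, G ω l) (dirichletMeasure α) P := by
  have : Nonempty (Fin n) := ⟨⟨0, hn⟩⟩
  have : IsProbabilityMeasure (gammaMeasure (∑ i, α i) 1) :=
    isProbabilityMeasure_gammaMeasure
      (Finset.sum_pos (fun i _ => hα i) Finset.univ_nonempty) one_pos
  exact measurePreserving_snd.fun_comp_hasLaw (hasLaw_sum_div hn hα hG)

lemma ae_sum_ne_zero (hn : 0 < n) (hα : ∀ i, 0 < α i)
    (hG : HasLaw G (Measure.pi fun i => gammaMeasure (α i) 1) P) :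
    ∀ᵐ ω ∂P, ∑ i, G ω i ≠ 0 := by
  have hS := hasLaw_sum hn hα hG
  refine ae_of_ae_map (p := fun s => s ≠ 0) hS.aemeasurable ?_
  rw [hS.map_eq]
  exact (withDensity_absolutelyContinuous _ _).ae_le (Measure.ae_ne volume 0)

end

/-! ### Independence -/

/-- Disjoint blocks of independent σ-algebras generate independent σ-algebras. -/
lemma ProbabilityTheory.iIndep.iSup_of_pairwise_disjoint {Ω ι κ : Type*} {mΩ : MeasurableSpace Ω}
    {μ : Measure Ω} {m : ι → MeasurableSpace Ω} (hm : ∀ i, m i ≤ mΩ) (h : iIndep m μ)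
    {B : κ → Set ι} (hB : Pairwise fun j l => Disjoint (B j) (B l)) :
    iIndep (fun j => ⨆ i ∈ B j, m i) μ := by
  classical
  have := h.isProbabilityMeasure
  rw [iIndep_iff]
  intro S f hf
  induction S using Finset.induction_on with
  | empty => simp
  | insert j S hj ih =>
    have hf' : ∀ l ∈ S, MeasurableSet[⨆ i ∈ B l, m i] (f l) :=
      fun l hl => hf l (Finset.mem_insert_of_mem hl)
    have hdisj : Disjoint (B j) (⋃ l ∈ S, B l) := by
      simp only [Set.disjoint_iUnion_right]
      exact fun l hl => hB (by rintro rfl; exact hj hl)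
    have hmeas : MeasurableSet[⨆ i ∈ ⋃ l ∈ S, B l, m i] (⋂ l ∈ S, f l) := by
      refine @Finset.measurableSet_biInter _ _ (_) _ S fun l hl => ?_
      have hle : (⨆ i ∈ B l, m i) ≤ ⨆ i ∈ ⋃ l ∈ S, B l, m i :=
        biSup_mono fun i hi => Set.mem_biUnion hl hi
      exact hle _ (hf' l hl)
    rw [Finset.set_biInter_insert, Finset.prod_insert hj, ← ih hf']
    exact (Indep_iff _ _ _).1 (indep_iSup_of_disjoint hm h hdisj) _ _
      (hf j (Finset.mem_insert_self _ _)) hmeas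

lemma ProbabilityTheory.iIndepFun.finset_sum {Ω ι κ : Type*} {mΩ : MeasurableSpace Ω}
    {μ : Measure Ω} {g : ι → Ω → ℝ} (hg : ∀ i, Measurable (g i)) (h : iIndepFun g μ)
    {B : κ → Finset ι} (hB : Pairwise fun j l => Disjoint (B j) (B l)) :
    iIndepFun (fun j ω => ∑ i ∈ B j, g i ω) μ := by
  rw [iIndepFun_iff_iIndep] at h ⊢
  have h' := h.iSup_of_pairwise_disjoint (fun i => (hg i).comap_le)
    (B := fun j => (B j : Set ι)) (fun j l hjl => Finset.disjoint_coe.2 (hB hjl))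
  refine iIndep_of_iIndep_of_le h' fun j => ?_
  rw [← measurable_iff_comap_le]
  refine Finset.measurable_sum (m := _) _ fun i hi => ?_
  rw [measurable_iff_comap_le]
  exact le_biSup (fun i => MeasurableSpace.comap (g i) inferInstance) (Finset.mem_coe.2 hi)

lemma ProbabilityTheory.iIndepFun.hasLaw_sum_gammaMeasure {Ω ι : Type*} {mΩ : MeasurableSpace Ω}
    {P : Measure Ω} {g : ι → Ω → ℝ} {α : ι → ℝ} (h : iIndepFun g P) (hα : ∀ i, 0 < α i)
    (hg : ∀ i, HasLaw (g i) (gammaMeasure (α i) 1) P) {B : Finset ι} (hB : B.Nonempty) :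
    HasLaw (fun ω => ∑ i ∈ B, g i ω) (gammaMeasure (∑ i ∈ B, α i) 1) P := by
  have key (f : ι → ℝ) : ∑ i ∈ B, f i = ∑ l, f (B.equivFin.symm l) := by
    rw [B.equivFin.symm.sum_comp fun i : B => f i, Finset.sum_coe_sort]
  simp_rw [key]
  have hinj : Function.Injective fun l => (B.equivFin.symm l : ι) :=
    Subtype.val_injective.comp B.equivFin.symm.injective
  exact hasLaw_sum hB.card_pos (fun l => hα _) ((h.precomp hinj).hasLaw_pi fun l => hg _)

/-- Independence of two functions of `X` depends only on the law of `X`. -/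
lemma ProbabilityTheory.HasLaw.indepFun_comp {Ω E F F' : Type*} {mΩ : MeasurableSpace Ω}
    {mE : MeasurableSpace E} {mF : MeasurableSpace F} {mF' : MeasurableSpace F'} {P : Measure Ω}
    {X : Ω → E} {μ : Measure E} (hX : HasLaw X μ P) {f : E → F} {f' : E → F'}
    (hf : Measurable f) (hf' : Measurable f') :
    IndepFun (fun ω => f (X ω)) (fun ω => f' (X ω)) P ↔ IndepFun f f' μ := by
  simp_rw [indepFun_iff_measure_inter_preimage_eq_mul]
  refine forall₄_congr fun s t hs ht => ?_
  rw [← hX.map_eq, Measure.map_apply_of_aemeasurable hX.aemeasurable ((hf hs).inter (hf' ht)),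
    Measure.map_apply_of_aemeasurable hX.aemeasurable (hf hs),
    Measure.map_apply_of_aemeasurable hX.aemeasurable (hf' ht)]
  rfl

lemma ProbabilityTheory.IndepFun.prodMk_right_of_prodMk_left {Ω E F F' : Type*}
    {mΩ : MeasurableSpace Ω} {mE : MeasurableSpace E} {mF : MeasurableSpace F}
    {mF' : MeasurableSpace F'} {P : Measure Ω} [IsProbabilityMeasure P] {U : Ω → E} {V : Ω → F}
    {W : Ω → F'} (hU : AEMeasurable U P) (hV : AEMeasurable V P) (hW : AEMeasurable W P)
    (hUV : IndepFun V U P)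
    (h : IndepFun (fun ω => (V ω, U ω)) W P) : IndepFun V (fun ω => (U ω, W ω)) P := by
  have := Measure.isProbabilityMeasure_map hU
  have := Measure.isProbabilityMeasure_map hV
  have := Measure.isProbabilityMeasure_map hW
  have hUW : IndepFun U W P := h.comp measurable_snd measurable_id
  rw [indepFun_iff_map_prod_eq_prod_map_map hV (hU.prodMk hW),
    hUW.map_prod_eq_prod_map_map hU hW, ← Measure.prodAssoc_prod,
    ← hUV.map_prod_eq_prod_map_map hV hU, ← h.map_prod_eq_prod_map_map (hV.prodMk hU) hW,
    AEMeasurable.map_map_of_aemeasurable (by fun_prop) (by fun_prop)]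
  rfl

/-! ### Aggregation and neutrality -/

theorem theorem3 {Ω : Type*} [MeasurableSpace Ω] (P : Measure Ω) [IsProbabilityMeasure P]
    (n : ℕ) (α : Fin n → ℝ) (hα : ∀ i, 0 < α i)
    (X : Ω → Fin n → ℝ) (hX : HasLaw X (dirichletMeasure α) P) :
    (∀ (k : ℕ) (B : Fin k → Finset (Fin n)),
      (∀ j, (B j).Nonempty) → Pairwise (fun j l => Disjoint (B j) (B l)) →
      (∀ i, ∃ j, i ∈ B j) →
      HasLaw (fun ω j => ∑ i ∈ B j, X ω i) (dirichletMeasure fun j => ∑ i ∈ B j, α i) P) ∧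
    (∀ (k : ℕ) (I : Fin k ↪ Fin n), 0 < k →
      HasLaw (fun ω j => X ω (I j) / ∑ l, X ω (I l)) (dirichletMeasure fun j => α (I j)) P ∧
      IndepFun (fun ω j => X ω (I j) / ∑ l, X ω (I l))
        (fun ω (i : {i : Fin n // i ∉ Set.range I}) => X ω i) P) := by
  have hn : 0 < n := by
    refine Nat.pos_of_ne_zero ?_
    rintro rfl
    have := Measure.isProbabilityMeasure_map hX.aemeasurable
    refine IsProbabilityMeasure.ne_zero (P.map X) ?_
    -- In dimension `0` the Dirichlet measure is `0`, which is not the law of anything.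
    rw [hX.map_eq, dirichletMeasure, hyperplaneVolume, withDensity_zero_left]
  have hprob (i : Fin n) : IsProbabilityMeasure (gammaMeasure (α i) 1) :=
    isProbabilityMeasure_gammaMeasure (hα i) one_pos
  set μ : Measure (Fin n → ℝ) := Measure.pi fun i => gammaMeasure (α i) 1
  have hind : iIndepFun (fun (i : Fin n) (g : Fin n → ℝ) => g i) μ :=
    iIndepFun_pi (X := fun _ t => t) fun i => aemeasurable_id
  have hlaw (i : Fin n) : HasLaw (fun g : Fin n → ℝ => g i) (gammaMeasure (α i) 1) μ :=
    (measurePreserving_eval (fun i => gammaMeasure (α i) 1) i).hasLaw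
  have hnorm : HasLaw (fun g i => g i / ∑ l, g l) (dirichletMeasure α) μ :=
    hasLaw_div_sum hn hα HasLaw.id
  constructor
  · intro k B hB hdisj hcover
    have hk : 0 < k := (hcover ⟨0, hn⟩).choose.pos
    refine hnorm.comp_of_hasLaw_comp (f := fun x j => ∑ i ∈ B j, x i) (by fun_prop) hX ?_
    have hblock := hasLaw_div_sum hk (fun j => Finset.sum_pos (fun i _ => hα i) (hB j))
      ((hind.finset_sum (fun i => measurable_pi_apply i) hdisj).hasLaw_pi fun j =>
        hind.hasLaw_sum_gammaMeasure hα hlaw (hB j))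
    have htotal (g : Fin n → ℝ) : ∑ j, ∑ i ∈ B j, g i = ∑ i, g i := by
      rw [← Finset.sum_biUnion fun j _ l _ hjl => hdisj hjl]
      congr 1
      ext i
      simpa using hcover i
    -- Normalizing and then summing over blocks is summing over blocks and then normalizing; no
    -- condition on the total is needed, both sides being `0` when it vanishes.
    simpa only [htotal, Finset.sum_div] using hblock
  · intro k I hk
    have hI : HasLaw (fun (g : Fin n → ℝ) j => g (I j))
        (Measure.pi fun j => gammaMeasure (α (I j)) 1) μ :=
      (hind.precomp I.injective).hasLaw_pi fun j => hlaw (I j)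
    have hαI (j) : 0 < α (I j) := hα (I j)
    -- The common factor `∑ l, g l` cancels only where it does not vanish, hence almost surely.
    have hcancel : (fun (g : Fin n → ℝ) (j : Fin k) =>
        (g (I j) / ∑ l, g l) / ∑ l, g (I l) / ∑ l, g l) =ᵐ[μ]
        fun g j => g (I j) / ∑ l, g (I l) := by
      filter_upwards [ae_sum_ne_zero hn hα (G := fun g => g) HasLaw.id] with g hg
      funext j
      rw [← Finset.sum_div, div_div_div_cancel_right₀ hg]
    have hV := hasLaw_div_sum hk hαI hI
    refine ⟨hnorm.comp_of_hasLaw_comp (f := fun x j => x (I j) / ∑ l, x (I l)) (by fun_prop) hX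
      (hV.congr hcancel), ?_⟩
    have hmI : Measurable fun (x : Fin n → ℝ) j => x (I j) / ∑ l, x (I l) := by fun_prop
    have hmIc : Measurable fun (x : Fin n → ℝ) (i : {i : Fin n // i ∉ Set.range I}) => x i := by
      fun_prop
    rw [hX.indepFun_comp hmI hmIc, ← hnorm.indepFun_comp hmI hmIc]
    have hUV : IndepFun (fun (g : Fin n → ℝ) j => g (I j) / ∑ l, g (I l))
        (fun g => ∑ l, g (I l)) μ := by
      refine IndepFun.symm ?_
      rw [indepFun_iff_hasLaw_prodMk_prod (hasLaw_sum hk hαI hI) hV]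
      exact hasLaw_sum_div hk hαI hI
    have hVW : IndepFun (fun (g : Fin n → ℝ) =>
        ((fun j => g (I j) / ∑ l, g (I l)), ∑ l, g (I l)))
        (fun g (i : {i : Fin n // i ∉ Set.range I}) => g i) μ := by
      classical
      have h := hind.indepFun_finset (Finset.univ.map I) (Finset.univ.map I)ᶜ disjoint_compl_right
        fun i => measurable_pi_apply i
      have hmem (j : Fin k) : I j ∈ Finset.univ.map I := by simp
      have hmemc (i : {i : Fin n // i ∉ Set.range I}) : (i : Fin n) ∈ (Finset.univ.map I)ᶜ := by
        simpa using i.2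
      exact h.comp
        (φ := fun y => ((fun j => y ⟨I j, hmem j⟩ / ∑ l, y ⟨I l, hmem l⟩), ∑ l, y ⟨I l, hmem l⟩))
        (ψ := fun y (i : {i : Fin n // i ∉ Set.range I}) => y ⟨i, hmemc i⟩)
        (by fun_prop) (by fun_prop)
    have hfinal := IndepFun.prodMk_right_of_prodMk_left
      (Measurable.aemeasurable (by fun_prop)) hmI.aemeasurable hmIc.aemeasurable hUV hVW
    -- The coordinates outside `I` of the normalized vector are a function of the sum over `I` and
    -- of the gamma variables outside `I`, of which the ratios inside `I` are jointly independent.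
    have hsplit (g : Fin n → ℝ) :
        ∑ i, g i = ∑ l, g (I l) + ∑ i : {i : Fin n // i ∉ Set.range I}, g i := by
      rw [← Fintype.sum_subtype_add_sum_subtype (· ∈ Set.range I) g]
      congr 1
      convert (Fintype.sum_equiv (Equiv.ofInjective I I.injective) (fun l => g (I l))
        (fun i => g i) fun _ => rfl).symm
    refine IndepFun.congr (hfinal.comp (φ := id)
      (ψ := fun p (i : {i : Fin n // i ∉ Set.range I}) => p.2 i / (p.1 + ∑ l, p.2 l))
      measurable_id (by fun_prop)) hcancel.symm (.of_forall fun g => ?_)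
    funext i
    simp [hsplit g]
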